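/- **Setting.** Let $\mathcal X$ be any set of records; datasets are finite subsets of $\mathcal X$. Two datasets are neighbours at the record $x$ if one is obtained from the other by adding $x$. A mechanism $M$ is $(\varepsilon,\delta)$-DP for $x$ if $\Pr(M(D)\in S)\le e^{\varepsilon}\Pr(M(D')\in S)+\delta$ for all $D,D'$ that are neighbours at $x$ (in either order) and all measurable $S$. Let $\mathcal L(\Theta,x)$ be a loss on $\mathbb R^d\times\mathcal X$, with per-sample gradients $\nabla_\Theta\mathcal L(\Theta,x)$ (read as $0$ where $\mathcal L(\cdot,x)$ is not differentiable), let $1\le k\le d$, and let $N$ be the public (nominal) training set size. Each stage has a number of steps $T$, a batch size $1\le B\le N$, a clipping threshold $C>0$, a noise multiplier $\sigma>0$, the sampling probability $q=B/N$, and an optimizer with internal state (any measurable update rule, such as SGD or Adam); the two stages may use different values. These parameters, including $q$ and $\sigma$, are public and are the same for neighbouring datasets. A batch contains every record of $D$ independently with probability $q$. Write $\mathrm{clip}_C(g)=g/\max(1,\|g\|_2/C)$. *Calibration.* $\mathrm{gdp}(\varepsilon,\delta,q,T)$ is the set of noise multipliers $\sigma>0$ such that, for $P_\sigma=\big((1-q)\mathcal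 N(0,\sigma^2)+q\,\mathcal N(1,\sigma^2)\big)^{\otimes T}$ and $Q_\sigma=\mathcal N(0,\sigma^2)^{\otimes T}$ on $\mathbb R^T$, one has $P_\sigma(S)\le e^{\varepsilon}Q_\sigma(S)+\delta$ and $Q_\sigma(S)\le e^{\varepsilon}P_\sigma(S)+\delta$ for all Borel $S\subseteq\mathbb R^T$. *Stage 1.* Start from $\Theta_1=\Theta_0$. For $t=1,\dots,T_1$ draw a batch $\mathcal B_t\subseteq D$, form $$\tilde g_t=\frac1{B_1}\sum_{x\in\mathcal B_t}\mathrm{clip}_{C_1}\big(\nabla_\Theta\mathcal L(\Theta_t,x)\big)+\mathcal N(0,\sigma_1^2C_1^2I_d),$$ and let the optimizer compute $\Theta_{t+1}$ from $\Theta_t$ and $\tilde g_t$. With $y=\lfloor T_1/k\rfloor$, let $A$ be the matrix with rows $\Theta_t-\Theta_0$ for $1\le t\le T_1$, $y\mid t$ (no rows if $T_1<k$). Let $P\in\mathbb R^{d\times k}$ consist of top-$k$ right singular vectors of $A$, chosen by a fixed measurable SVD routine. Output $\Theta^*=\Theta_{T_1+1}$ and $P$. *Stage 2.* On the same $D$,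 with fresh randomness, start from $\Theta_1=\Theta^*$. For $t=1,\dots,T_2$ draw a batch $\mathcal B_t$, form $$\tilde g^s_t=\frac1{B_2}\sum_{x\in\mathcal B_t}\mathrm{clip}_{C_2}\big(P^\top\nabla_\Theta\mathcal L(\Theta_t,x)\big)+\mathcal N(0,\sigma_2^2C_2^2I_k),\qquad \tilde g_t=P\tilde g^s_t,$$ and let the optimizer compute $\Theta_{t+1}$ from $\Theta_t$ and $\tilde g_t$. Output $\Theta=\Theta_{T_2+1}$. **Theorem (Differential Privacy of DP-SFT).** Let $\varepsilon\ge0$, $\delta>0$ and $p_1,p_2\in(0,1)$ with $p_1+p_2=1$. Then $\mathrm{gdp}(p_i\varepsilon,p_i\delta,q_i,T_i)\ne\emptyset$ for $i=1,2$. For all $\sigma_i\in\mathrm{gdp}(p_i\varepsilon,p_i\delta,q_i,T_i)$, every $\Theta_0\in\mathbb R^d$ and every record $x\in\mathcal X$: 1. stage 1, releasing $(\Theta^*,P)$, is $(p_1\varepsilon,p_1\delta)$-DP for $x$; 2. stage 2, for every fixed input $(\Theta^*,P)\in\mathbb R^d\times\mathbb R^{d\times k}$, is $(p_2\varepsilon,p_2\delta)$-DP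 for $x$; 3. the two-stage DP-SFT procedure, releasing $(\Theta^*,P,\Theta)$ and hence in particular when it releases only $\Theta$, is $(\varepsilon,\delta)$-DP for $x$. -/

import Mathlib

open MeasureTheory ProbabilityTheory
open scoped ENNReal

namespace DPSFT

/-! ### Differential privacy -/

/-- `μ` and `ν` satisfy the one-sided `(ε, δ)`-inequality
`μ S ≤ exp ε * ν S + δ` for every event `S`. -/
def Close {Y : Type*} [MeasurableSpace Y] (ε δ : ℝ) (μ ν : Measure Y) : Prop :=
  ∀ S : Set Y, MeasurableSet S →
    μ S ≤ ENNReal.ofReal (Real.exp ε) * ν S + ENNReal.ofReal δ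

/-- `D` and `D'` are neighbours that differ in the presence of the single record `x`. -/
def NeighboursAt {X : Type*} (x : X) (D D' : Finset X) : Prop :=
  (∃ h : x ∉ D, D' = D.cons x h) ∨ (∃ h : x ∉ D', D = D'.cons x h)

/-- `(ε, δ)`-differential privacy of a mechanism (given by its output laws) for the record `x`. -/
def IsDPFor {X Y : Type*} [MeasurableSpace Y] (x : X) (ε δ : ℝ)
    (M : Finset X → Measure Y) : Prop :=
  ∀ D D' : Finset X, NeighboursAt x D D' → Close ε δ (M D) (M D')

/-! ### The accountant: calibration of the noise multiplier -/

/-- The mixture `(1 - q) N(0, σ²) + q N(1, σ²)` on the line. -/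
noncomputable def gaussMixture (q σ : ℝ) : Measure ℝ :=
  ENNReal.ofReal (1 - q) • gaussianReal 0 (σ ^ 2).toNNReal +
    ENNReal.ofReal q • gaussianReal 1 (σ ^ 2).toNNReal

/-- The noise multipliers `σ > 0` that the numerical accountant for the `T`-fold composed,
`q`-subsampled Gaussian mechanism certifies for `(ε, δ)`: both privacy curves of the pair
`((1 - q) N(0, σ²) + q N(1, σ²))^{⊗ T}`, `N(0, σ²)^{⊗ T}` are at most `δ` at `ε`. -/
def gdp (ε δ q : ℝ) (T : ℕ) : Set ℝ :=
  {σ | 0 < σ ∧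
    Close ε δ (Measure.pi fun _ : Fin T => gaussMixture q σ)
      (Measure.pi fun _ : Fin T => gaussianReal 0 (σ ^ 2).toNNReal) ∧
    Close ε δ (Measure.pi fun _ : Fin T => gaussianReal 0 (σ ^ 2).toNNReal)
      (Measure.pi fun _ : Fin T => gaussMixture q σ)}

/-! ### Hyperparameters, optimizers, truncated SVD -/

/-- Flattened model parameters. -/
abbrev Params (d : ℕ) := EuclideanSpace ℝ (Fin d)

/-- Hyperparameters of one stage, for the public training set size `N`:
number of steps, (expected) batch size, clipping threshold. -/
structure Hyper (N : ℕ) where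
  T : ℕ
  B : ℕ
  C : ℝ
  B_pos : 0 < B
  B_le : B ≤ N
  C_pos : 0 < C

/-- The sampling probability `B / N`. -/
noncomputable def Hyper.q {N : ℕ} (h : Hyper N) : ℝ := (h.B : ℝ) / N

/-- A first-order optimizer with internal state in `Ω` (the learning rate is part of it).
`step ((ω, θ), g)` is the new state and the new parameter vector after seeing the gradient `g`. -/
structure Optimizer (Ω : Type*) [MeasurableSpace Ω] (d : ℕ) where
  init : Ω
  step : (Ω × Params d) × Params d → Ω × Params d
  measurable_step : Measurable step

/-- Stochastic gradient descent with learning rate `η`. -/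
noncomputable def sgd (d : ℕ) (η : ℝ) : Optimizer Unit d where
  init := ()
  step p := ((), p.1.2 - η • p.2)
  measurable_step := by fun_prop

/-- One step of Adam; the state is (number of steps so far, first moment, second moment). -/
noncomputable def adamStep (d : ℕ) (η β₁ β₂ e : ℝ)
    (p : ((ℕ × Params d × Params d) × Params d) × Params d) :
    (ℕ × Params d × Params d) × Params d :=
  let t := p.1.1.1 + 1
  let m : Params d := β₁ • p.1.1.2.1 + (1 - β₁) • p.2
  let v : Params d := β₂ • p.1.1.2.2 + (1 - β₂) • WithLp.toLp 2 (fun i => p.2 i ^ 2)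
  ((t, m, v), p.1.2 - η • WithLp.toLp 2
    (fun i => (m i / (1 - β₁ ^ t)) / (Real.sqrt (v i / (1 - β₂ ^ t)) + e)))

/-- Adam with learning rate `η` and constants `β₁, β₂, e`. -/
noncomputable def adam (d : ℕ) (η β₁ β₂ e : ℝ) : Optimizer (ℕ × Params d × Params d) d where
  init := (0, 0, 0)
  step := adamStep d η β₁ β₂ e
  measurable_step := by
    unfold adamStep
    have hpow : ∀ b : ℝ, Measurable fun n : ℕ => b ^ n := fun b => measurable_from_top
    have h1 := hpow β₁
    have h2 := hpow β₂
    fun_prop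

instance {m n : Type*} : MeasurableSpace (Matrix m n ℝ) :=
  inferInstanceAs (MeasurableSpace (m → n → ℝ))

/-- The columns of `P` are top-`k` right singular vectors of `A`: they are the first `k` columns
of `W` in some singular value decomposition `A = U Σ Wᵀ` with singular values in
nonincreasing order. -/
def IsTopRightSingular {m d k : ℕ} (hk : k ≤ d)
    (A : Matrix (Fin m) (Fin d) ℝ) (P : Matrix (Fin d) (Fin k) ℝ) : Prop :=
  ∃ U ∈ Matrix.orthogonalGroup (Fin m) ℝ, ∃ W ∈ Matrix.orthogonalGroup (Fin d) ℝ,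
    ∃ s : ℕ → ℝ, Antitone s ∧ (∀ i, 0 ≤ s i) ∧
      A = U * (Matrix.of fun (i : Fin m) (j : Fin d) =>
        if (i : ℕ) = j then s i else 0) * W.transpose ∧
      ∀ (i : Fin d) (j : Fin k), P i j = W i (Fin.castLE hk j)

/-- A (deterministic, measurable) truncated SVD routine: any measurable way of choosing, for each
matrix `A`, a matrix of top-`k` right singular vectors of `A`. -/
structure SVDRoutine (m : ℕ) {d k : ℕ} (hk : k ≤ d) where
  toFun : Matrix (Fin m) (Fin d) ℝ → Matrix (Fin d) (Fin k) ℝ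
  measurable_toFun : Measurable toFun
  isTop : ∀ A, IsTopRightSingular hk A (toFun A)

/-! ### Noisy clipped mean gradients over a random batch -/

/-- Clipping of `g` to norm at most `C`: `g / max(1, ‖g‖ / C)`. -/
noncomputable def clip {n : ℕ} (C : ℝ) (g : EuclideanSpace ℝ (Fin n)) :
    EuclideanSpace ℝ (Fin n) :=
  (max 1 (‖g‖ / C))⁻¹ • g

/-- The normal law `N(0, s² I_n)` on `ℝⁿ`. -/
noncomputable def gaussianNoise (n : ℕ) (s : ℝ) : Measure (EuclideanSpace ℝ (Fin n)) :=
  (stdGaussian (EuclideanSpace ℝ (Fin n))).map (fun z => s • z)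

instance (n : ℕ) (s : ℝ) : IsProbabilityMeasure (gaussianNoise n s) :=
  Measure.isProbabilityMeasure_map (by fun_prop)

/-- `(1 / B) ∑_{x ∈ b} clip_C (g x)`. -/
noncomputable def clippedMean {X : Type*} {n : ℕ} (B : ℕ) (C : ℝ)
    (g : X → EuclideanSpace ℝ (Fin n)) (b : Finset X) : EuclideanSpace ℝ (Fin n) :=
  (B : ℝ)⁻¹ • ∑ x ∈ b, clip C (g x)

/-- The probability that the random batch drawn from `D` equals `b ⊆ D`, when every record of `D`
is included independently with probability `q`. -/
noncomputable def batchProb {X : Type*} (q : ℝ) (D b : Finset X) : ℝ :=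
  q ^ b.card * (1 - q) ^ (D.card - b.card)

/-- Sample a batch `b` from `D`, including every record independently with probability `B / N`,
and output `(1 / B) ∑_{x ∈ b} clip_C (g x s) + N(0, σ² C² I_n)`; here `g x s` is the gradient of
record `x` when the algorithm is in the state `s`. -/
noncomputable def noisyMean {X S : Type*} [MeasurableSpace S] {n N : ℕ} (h : Hyper N) (σ : ℝ)
    (g : X → S → EuclideanSpace ℝ (Fin n)) (hg : ∀ x, Measurable (g x)) (D : Finset X) :
    Kernel S (EuclideanSpace ℝ (Fin n)) where
  toFun s := ∑ b ∈ D.powerset, ENNReal.ofReal (batchProb h.q D b) •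
    (gaussianNoise n (σ * h.C)).map (fun z => clippedMean h.B h.C (fun x => g x s) b + z)
  measurable' := by
    refine Measure.measurable_of_measurable_coe _ fun A hA => ?_
    simp only [Measure.coe_finsetSum, Finset.sum_apply, Measure.smul_apply, smul_eq_mul]
    refine Finset.measurable_sum _ fun b _ => Measurable.const_mul ?_ _
    have hm : Measurable fun p : S × EuclideanSpace ℝ (Fin n) =>
        clippedMean h.B h.C (fun x => g x p.1) b + p.2 := by
      unfold clippedMean clip
      fun_prop
    have e : (fun s => (gaussianNoise n (σ * h.C)).map
        (fun z => clippedMean h.B h.C (fun x => g x s) b + z) A) =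
        fun s => gaussianNoise n (σ * h.C) (Prod.mk s ⁻¹'
          ((fun p : S × EuclideanSpace ℝ (Fin n) =>
            clippedMean h.B h.C (fun x => g x p.1) b + p.2) ⁻¹' A)) := by
      funext s
      rw [Measure.map_apply (by fun_prop) hA]
      rfl
    rw [e]
    exact measurable_measure_prodMk_left (hm hA)

theorem Hyper.q_nonneg {N : ℕ} (h : Hyper N) : 0 ≤ h.q := by
  unfold Hyper.q; positivity

theorem Hyper.q_le_one {N : ℕ} (h : Hyper N) : h.q ≤ 1 := by
  unfold Hyper.q
  exact div_le_one_of_le₀ (by exact_mod_cast h.B_le) (by positivity)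

instance {X S : Type*} [MeasurableSpace S] {n N : ℕ} (h : Hyper N) (σ : ℝ)
    (g : X → S → EuclideanSpace ℝ (Fin n)) (hg : ∀ x, Measurable (g x)) (D : Finset X) :
    IsMarkovKernel (noisyMean h σ g hg D) := by
  refine ⟨fun s => ⟨?_⟩⟩
  have h1 : ∀ b ∈ D.powerset, 0 ≤ batchProb h.q D b := fun b _ =>
    mul_nonneg (pow_nonneg h.q_nonneg _) (pow_nonneg (sub_nonneg.2 h.q_le_one) _)
  have h2 : ∑ b ∈ D.powerset, batchProb h.q D b = 1 := by
    have := Finset.sum_pow_mul_eq_add_pow h.q (1 - h.q) D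
    simpa [batchProb] using this
  have h3 : ∀ b : Finset X, ((gaussianNoise n (σ * h.C)).map
      (fun z => clippedMean h.B h.C (fun x => g x s) b + z)) Set.univ = 1 := fun b => by
    rw [Measure.map_apply (by fun_prop) MeasurableSet.univ, Set.preimage_univ, measure_univ]
  change (∑ b ∈ D.powerset, ENNReal.ofReal (batchProb h.q D b) •
    (gaussianNoise n (σ * h.C)).map
      (fun z => clippedMean h.B h.C (fun x => g x s) b + z)) Set.univ = 1
  simp only [Measure.coe_finsetSum, Finset.sum_apply, Measure.smul_apply, smul_eq_mul, h3,
    mul_one]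
  rw [← ENNReal.ofReal_sum_of_nonneg h1, h2, ENNReal.ofReal_one]

/-! ### The training loop -/

/-- `T` optimizer steps. `A` is the type of inputs of the stage, `start` gives the initial
parameters, and `G` is the law of the noisy gradient given the input and the current parameters.
The output is the sequence of the `T + 1` optimizer states and parameter vectors; its entry `t`
is the one after `t` steps. -/
noncomputable def train {A Ω : Type*} [MeasurableSpace A] [MeasurableSpace Ω] {d : ℕ}
    (opt : Optimizer Ω d) (start : A → Params d) (hstart : Measurable start)
    (G : Kernel (A × Params d) (Params d)) : (T : ℕ) → Kernel A (Fin (T + 1) → Ω × Params d)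
  | 0 => Kernel.deterministic (fun a _ => (opt.init, start a)) (by fun_prop)
  | T + 1 =>
    (train opt start hstart G T ⊗ₖ
      ((Kernel.id ×ₖ G.comap
          (fun p : A × (Fin (T + 1) → Ω × Params d) => (p.1, (p.2 (Fin.last T)).2))
          (by fun_prop)).map
        fun r => opt.step (r.1.2 (Fin.last T), r.2))).map
      fun p => Fin.snoc (α := fun _ => Ω × Params d) p.1 p.2

theorem measurable_snoc {Z : Type*} [MeasurableSpace Z] (n : ℕ) :
    Measurable fun p : (Fin n → Z) × Z => Fin.snoc (α := fun _ => Z) p.1 p.2 := by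
  refine measurable_pi_lambda _ fun i => ?_
  induction i using Fin.lastCases with
  | last => simpa using measurable_snd
  | cast j =>
    simp only [Fin.snoc_castSucc]
    fun_prop

instance {A Ω : Type*} [MeasurableSpace A] [MeasurableSpace Ω] {d : ℕ}
    (opt : Optimizer Ω d) (start : A → Params d) (hstart : Measurable start)
    (G : Kernel (A × Params d) (Params d)) [IsMarkovKernel G] (T : ℕ) :
    IsMarkovKernel (train opt start hstart G T) := by
  induction T with
  | zero => unfold train; infer_instance
  | succ T ih =>
    unfold train
    have hs : Measurable fun r : (A × (Fin (T + 1) → Ω × Params d)) × Params d =>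
        opt.step (r.1.2 (Fin.last T), r.2) := opt.measurable_step.comp (by fun_prop)
    have := Kernel.IsMarkovKernel.map (Kernel.id ×ₖ G.comap
          (fun p : A × (Fin (T + 1) → Ω × Params d) => (p.1, (p.2 (Fin.last T)).2))
          (by fun_prop)) hs
    exact Kernel.IsMarkovKernel.map _ (measurable_snoc _)

/-! ### Stage 1: subspace construction -/

/-- Per-sample gradient of the loss `L θ x` with respect to `θ`. -/
noncomputable def grad {X : Type*} {d : ℕ} (L : Params d → X → ℝ) (x : X) (θ : Params d) :
    Params d :=
  gradient (fun θ => L θ x) θ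

theorem measurable_grad {X : Type*} {d : ℕ} (L : Params d → X → ℝ) (x : X) :
    Measurable (grad L x) :=
  (InnerProductSpace.toDual ℝ (Params d)).symm.continuous.measurable.comp
    (measurable_fderiv ℝ fun θ => L θ x)

/-- Law of the noisy full-dimensional gradient (the first component, the input of the stage, is
not used). -/
noncomputable def fullNoisyGrad {X : Type*} {d N : ℕ} (L : Params d → X → ℝ) (h : Hyper N)
    (σ : ℝ) (D : Finset X) : Kernel (Params d × Params d) (Params d) :=
  noisyMean h σ (fun x s => grad L x s.2) (fun x => (measurable_grad L x).comp measurable_snd) D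

/-- Number of recorded trajectory points, `#{t ∈ {1, …, T} : y ∣ t}` for the period
`y = ⌊T / k⌋`. -/
def numRows (T k : ℕ) : ℕ := T / (T / k)

theorem row_lt {T k : ℕ} (j : Fin (numRows T k)) : (j + 1) * (T / k) - 1 < T + 1 := by
  have h1 : ((j : ℕ) + 1) * (T / k) ≤ numRows T k * (T / k) := Nat.mul_le_mul_right _ j.2
  have h2 : numRows T k * (T / k) ≤ T := Nat.div_mul_le_self _ _
  omega

/-- The trajectory matrix: its rows are `Θ_t - Θ_0` for the `t ∈ {1, …, T}` that are multiples of
`y = ⌊T / k⌋`. Here `Θ_t` is the parameter vector at the beginning of step `t`, that is, after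
`t - 1` updates. -/
def trajMatrix {Ω : Type*} {d : ℕ} (T k : ℕ) (s : Fin (T + 1) → Ω × Params d) :
    Matrix (Fin (numRows T k)) (Fin d) ℝ :=
  Matrix.of fun j i => (s ⟨(j + 1) * (T / k) - 1, row_lt j⟩).2 i - (s 0).2 i

/-- The output `(Θ*, P)` of stage 1, from its sequence of states. -/
def stage1Output {Ω : Type*} {d k : ℕ} {hk : k ≤ d} (T : ℕ)
    (svd : SVDRoutine (numRows T k) hk) (s : Fin (T + 1) → Ω × Params d) :
    Params d × Matrix (Fin d) (Fin k) ℝ :=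
  ((s (Fin.last T)).2, svd.toFun (trajMatrix T k s))

theorem measurable_stage1Output {Ω : Type*} [MeasurableSpace Ω] {d k : ℕ} {hk : k ≤ d} (T : ℕ)
    (svd : SVDRoutine (numRows T k) hk) :
    Measurable (stage1Output (Ω := Ω) T svd) := by
  refine Measurable.prodMk (by fun_prop) (svd.measurable_toFun.comp ?_)
  refine measurable_pi_lambda _ fun j => measurable_pi_lambda _ fun i => ?_
  change Measurable fun s : Fin (T + 1) → Ω × Params d =>
    (s ⟨(j + 1) * (T / k) - 1, row_lt j⟩).2 i - (s 0).2 i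
  fun_prop

/-- Stage 1: law of `(Θ*, P)` given the initial parameters `Θ_0`. -/
noncomputable def stage1 {X Ω : Type*} [MeasurableSpace Ω] {d k N : ℕ} {hk : k ≤ d}
    (L : Params d → X → ℝ) (opt : Optimizer Ω d) (h : Hyper N)
    (svd : SVDRoutine (numRows h.T k) hk) (σ : ℝ) (D : Finset X) :
    Kernel (Params d) (Params d × Matrix (Fin d) (Fin k) ℝ) :=
  (train opt id measurable_id (fullNoisyGrad L h σ D) h.T).map (stage1Output h.T svd)

instance {X Ω : Type*} [MeasurableSpace Ω] {d k N : ℕ} {hk : k ≤ d}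
    (L : Params d → X → ℝ) (opt : Optimizer Ω d) (h : Hyper N)
    (svd : SVDRoutine (numRows h.T k) hk) (σ : ℝ) (D : Finset X) :
    IsMarkovKernel (stage1 L opt h svd σ D) := by
  have : IsMarkovKernel (fullNoisyGrad L h σ D) := by unfold fullNoisyGrad; infer_instance
  exact Kernel.IsMarkovKernel.map _ (measurable_stage1Output _ _)

/-! ### Stage 2: private training in the subspace -/

/-- `M v` for a matrix `M` and a vector `v`. -/
def matVec {m n : ℕ} (M : Matrix (Fin m) (Fin n) ℝ) (v : EuclideanSpace ℝ (Fin n)) :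
    EuclideanSpace ℝ (Fin m) :=
  WithLp.toLp 2 (M.mulVec v.ofLp)

theorem measurable_matVec {m n : ℕ} :
    Measurable fun p : Matrix (Fin m) (Fin n) ℝ × EuclideanSpace ℝ (Fin n) =>
      matVec p.1 p.2 := by
  have hM : ∀ i j, Measurable fun p : Matrix (Fin m) (Fin n) ℝ × EuclideanSpace ℝ (Fin n) =>
      p.1 i j := fun i j =>
    (measurable_pi_apply j).comp ((measurable_pi_apply (X := fun _ : Fin m => Fin n → ℝ) i).comp
      measurable_fst)
  unfold matVec Matrix.mulVec dotProduct
  fun_prop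

theorem measurable_transpose {m n : ℕ} :
    Measurable fun M : Matrix (Fin m) (Fin n) ℝ => M.transpose :=
  measurable_pi_lambda _ fun j => measurable_pi_lambda _ fun i =>
    (measurable_pi_apply j).comp (measurable_pi_apply (X := fun _ : Fin m => Fin n → ℝ) i)

/-- Law of the noisy mean of the projected, then clipped gradients, in `ℝᵏ`; the input of the
stage is `(Θ*, P)`. -/
noncomputable def subspaceNoisyGrad {X : Type*} {d k N : ℕ} (L : Params d → X → ℝ) (h : Hyper N)
    (σ : ℝ) (D : Finset X) :
    Kernel ((Params d × Matrix (Fin d) (Fin k) ℝ) × Params d) (EuclideanSpace ℝ (Fin k)) :=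
  noisyMean h σ (fun x s => matVec s.1.2.transpose (grad L x s.2))
    (fun x => measurable_matVec.comp
      (((measurable_transpose.comp (measurable_snd.comp measurable_fst))).prodMk
        ((measurable_grad L x).comp measurable_snd))) D

/-- The noisy gradient of `subspaceNoisyGrad`, mapped back to `ℝᵈ` by `P`. -/
noncomputable def liftedNoisyGrad {X : Type*} {d k N : ℕ} (L : Params d → X → ℝ) (h : Hyper N)
    (σ : ℝ) (D : Finset X) :
    Kernel ((Params d × Matrix (Fin d) (Fin k) ℝ) × Params d) (Params d) :=
  (Kernel.id ×ₖ subspaceNoisyGrad L h σ D).map fun r => matVec r.1.1.2 r.2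

/-- Stage 2: law of the final parameters `Θ` given `(Θ*, P)`. -/
noncomputable def stage2 {X Ω : Type*} [MeasurableSpace Ω] {d k N : ℕ}
    (L : Params d → X → ℝ) (opt : Optimizer Ω d) (h : Hyper N) (σ : ℝ) (D : Finset X) :
    Kernel (Params d × Matrix (Fin d) (Fin k) ℝ) (Params d) :=
  (train opt Prod.fst measurable_fst (liftedNoisyGrad L h σ D) h.T).map
    fun s => (s (Fin.last h.T)).2

instance {X Ω : Type*} [MeasurableSpace Ω] {d k N : ℕ}
    (L : Params d → X → ℝ) (opt : Optimizer Ω d) (h : Hyper N) (σ : ℝ) (D : Finset X) :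
    IsMarkovKernel (stage2 (k := k) L opt h σ D) := by
  have h1 : IsMarkovKernel (subspaceNoisyGrad (k := k) L h σ D) := by
    unfold subspaceNoisyGrad; infer_instance
  have h2 : IsMarkovKernel (liftedNoisyGrad (k := k) L h σ D) :=
    Kernel.IsMarkovKernel.map _ (measurable_matVec.comp
      ((measurable_snd.comp (measurable_fst.comp measurable_fst)).prodMk measurable_snd))
  exact Kernel.IsMarkovKernel.map _ (by fun_prop)

/-! ### The two-stage procedure -/

/-- DP-SFT: run stage 1 on `D` from `Θ_0` to get `(Θ*, P)`, then stage 2 on the same `D` with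
input `(Θ*, P)` and fresh randomness to get `Θ`; release `((Θ*, P), Θ)`. -/
noncomputable def dpsft {X Ω₁ Ω₂ : Type*} [MeasurableSpace Ω₁] [MeasurableSpace Ω₂]
    {d k N : ℕ} {hk : k ≤ d} (L : Params d → X → ℝ) (opt₁ : Optimizer Ω₁ d)
    (opt₂ : Optimizer Ω₂ d) (h₁ h₂ : Hyper N) (svd : SVDRoutine (numRows h₁.T k) hk)
    (σ₁ σ₂ : ℝ) (D : Finset X) :
    Kernel (Params d) ((Params d × Matrix (Fin d) (Fin k) ℝ) × Params d) :=
  stage1 L opt₁ h₁ svd σ₁ D ⊗ₖ Kernel.prodMkLeft (Params d) (stage2 L opt₂ h₂ σ₂ D)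

instance {X Ω₁ Ω₂ : Type*} [MeasurableSpace Ω₁] [MeasurableSpace Ω₂]
    {d k N : ℕ} {hk : k ≤ d} (L : Params d → X → ℝ) (opt₁ : Optimizer Ω₁ d)
    (opt₂ : Optimizer Ω₂ d) (h₁ h₂ : Hyper N) (svd : SVDRoutine (numRows h₁.T k) hk)
    (σ₁ σ₂ : ℝ) (D : Finset X) :
    IsMarkovKernel (dpsft L opt₁ opt₂ h₁ h₂ svd σ₁ σ₂ D) := by
  unfold dpsft; infer_instance

end DPSFT

namespace DPSFT

/-! ### Calculus of the one-sided `(ε, δ)`-inequality -/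

/-! Fix a dataset `D` without the record `x`. Adding `x` to a batch moves the clipped mean by a
vector v = clip(g)/B, and ‖v‖ ≤ C because B ≥ 1. Since σ‖v‖ ≤ σC, noise of law N(0, σ²C² I) splits
as z v + R, where z ~ N(0, σ²) and R is an independent centred Gaussian of covariance σ²C² I - σ² v
vᵀ. Giving z the mean 1 instead of 0 translates the sum by exactly v. Hence one Markov kernel,
`noisyMeanSim`, turns the scalar law N(0, σ²) into the noisy mean on `D` (`simulates_noisyMean`) and
the mixture (1 - q) N(0, σ²) + q N(1, σ²) into the noisy mean on `D` with `x` added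
(`simulates_noisyMean_cons`).

During training v depends on the current state, but the scalar laws do not. So a single kernel
builds the whole trajectory from T independent scalars (`Simulates.train`). The trajectory laws on
the two neighbours are images of exactly the pair of product laws that defines `gdp`, and both
inequalities pass to any function of the trajectory by data processing (`Close.of_eq_lintegral`).
Adaptive composition (`Close.compProd`) then joins the stages.

Calibration is possible because the mixture is within 1/σ of N(0, σ²) in total variation, hence
within T/σ after T steps, which is below δ for large σ. -/

theorem Close.mono {Y : Type*} [MeasurableSpace Y] {ε ε' δ δ' : ℝ} {μ ν : Measure Y}
    (h : Close ε δ μ ν) (hε : ε ≤ ε') (hδ : δ ≤ δ') : Close ε' δ' μ ν := fun S hS =>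
  (h S hS).trans (by gcongr)

/-- The inequality for events extends to `[0, 1]`-valued test functions. -/
theorem Close.lintegral_le {Y : Type*} [MeasurableSpace Y] {ε δ : ℝ} {μ ν : Measure Y}
    (h : Close ε δ μ ν) {f : Y → ℝ≥0∞} (hf : Measurable f) (hf1 : ∀ y, f y ≤ 1) :
    ∫⁻ y, f y ∂μ ≤ ENNReal.ofReal (Real.exp ε) * ∫⁻ y, f y ∂ν + ENNReal.ofReal δ := by
  -- Layer-cake formula. As `f ≤ 1`, only levels in (0, 1) matter; this interval has length one, so
  -- the additive term integrates to exactly `δ`.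
  have layer : ∀ ρ : Measure Y,
      ∫⁻ y, f y ∂ρ = ∫⁻ t in Set.Ioo (0 : ℝ) 1, ρ {y | t < (f y).toReal} := by
    intro ρ
    have e1 : ∫⁻ y, f y ∂ρ = ∫⁻ y, ENNReal.ofReal (f y).toReal ∂ρ :=
      lintegral_congr fun y => (ENNReal.ofReal_toReal ((hf1 y).trans_lt ENNReal.one_lt_top).ne).symm
    rw [e1, lintegral_eq_lintegral_meas_lt ρ (ae_of_all _ fun y => ENNReal.toReal_nonneg)
      hf.ennreal_toReal.aemeasurable]
    rw [← lintegral_indicator measurableSet_Ioi, ← lintegral_indicator measurableSet_Ioo]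
    refine lintegral_congr fun t => ?_
    by_cases ht1 : t < 1
    · simp only [Set.indicator, Set.mem_Ioi, Set.mem_Ioo, ht1, and_true]
    rw [Set.indicator_of_notMem (s := Set.Ioo (0 : ℝ) 1) fun ht => ht1 ht.2, Set.indicator_apply_eq_zero]
    intro _
    have : {y | t < (f y).toReal} = ∅ := by
      refine Set.eq_empty_of_forall_notMem fun y hy => ?_
      have h2 : (f y).toReal ≤ 1 := ENNReal.toReal_le_of_le_ofReal zero_le_one (by simpa using hf1 y)
      exact ht1 (lt_of_lt_of_le hy h2)
    rw [this, measure_empty]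
  rw [layer μ, layer ν]
  have hanti : Antitone fun t : ℝ => ν {y | t < (f y).toReal} := fun s t hst =>
    measure_mono fun y (hy : t < _) => hst.trans_lt hy
  calc ∫⁻ t in Set.Ioo (0 : ℝ) 1, μ {y | t < (f y).toReal}
      ≤ ∫⁻ t in Set.Ioo (0 : ℝ) 1, (ENNReal.ofReal (Real.exp ε) * ν {y | t < (f y).toReal}
          + ENNReal.ofReal δ) :=
        lintegral_mono fun t => h _ (measurableSet_lt measurable_const hf.ennreal_toReal)
    _ = _ := by
        rw [lintegral_add_right _ measurable_const, lintegral_const_mul _ hanti.measurable]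
        simp

/-- Data processing. -/
theorem Close.of_eq_lintegral {Y Z : Type*} [MeasurableSpace Y] [MeasurableSpace Z] {ε δ : ℝ}
    {P Q : Measure Z} {μ ν : Measure Y} (h : Close ε δ P Q) (κ : Kernel Z Y) [IsMarkovKernel κ]
    (hμ : ∀ S, MeasurableSet S → μ S = ∫⁻ z, κ z S ∂P)
    (hν : ∀ S, MeasurableSet S → ν S = ∫⁻ z, κ z S ∂Q) : Close ε δ μ ν := fun S hS => by
  rw [hμ S hS, hν S hS]
  exact h.lintegral_le (κ.measurable_coe hS) fun _ => prob_le_one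

theorem Close.map {Y Z : Type*} [MeasurableSpace Y] [MeasurableSpace Z] {ε δ : ℝ}
    {P Q : Measure Z} (h : Close ε δ P Q) {f : Z → Y} (hf : Measurable f) :
    Close ε δ (P.map f) (Q.map f) := fun S hS => by
  rw [Measure.map_apply hf hS, Measure.map_apply hf hS]
  exact h _ (hf hS)

/-- Basic adaptive composition. -/
theorem Close.compProd {Y Z : Type*} [MeasurableSpace Y] [MeasurableSpace Z]
    {ε₁ δ₁ ε₂ δ₂ : ℝ} {μ ν : Measure Y} [IsProbabilityMeasure μ] [IsProbabilityMeasure ν]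
    {κ η : Kernel Y Z} [IsMarkovKernel κ] [IsMarkovKernel η] (hδ₁ : 0 ≤ δ₁) (hδ₂ : 0 ≤ δ₂)
    (h₁ : Close ε₁ δ₁ μ ν) (h₂ : ∀ y, Close ε₂ δ₂ (κ y) (η y)) :
    Close (ε₁ + ε₂) (δ₁ + δ₂) (μ ⊗ₘ κ) (ν ⊗ₘ η) := fun S hS => by
  rw [Measure.compProd_apply hS, Measure.compProd_apply hS]
  set e₂ := ENNReal.ofReal (Real.exp ε₂)
  set g : Y → ℝ≥0∞ := fun y => η y (Prod.mk y ⁻¹' S)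
  have hg : Measurable g := Kernel.measurable_kernel_prodMk_left hS
  -- Truncating at 1 makes the integrand a `[0, 1]`-valued test function, to which `h₁` applies;
  -- bounding `κ` by `e₂ * g` alone would not allow this.
  calc ∫⁻ y, κ y (Prod.mk y ⁻¹' S) ∂μ
      ≤ ∫⁻ y, (min 1 (e₂ * g y) + ENNReal.ofReal δ₂) ∂μ := by
        refine lintegral_mono fun y => ?_
        rw [min_add]
        exact le_min (prob_le_one.trans le_self_add) (h₂ y _ (measurable_prodMk_left hS))
    _ = ∫⁻ y, min 1 (e₂ * g y) ∂μ + ENNReal.ofReal δ₂ := by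
        rw [lintegral_add_right _ measurable_const]; simp
    _ ≤ (ENNReal.ofReal (Real.exp ε₁) * ∫⁻ y, min 1 (e₂ * g y) ∂ν + ENNReal.ofReal δ₁)
          + ENNReal.ofReal δ₂ := by
        gcongr
        exact h₁.lintegral_le (measurable_const.min (hg.const_mul _)) fun y => min_le_left _ _
    _ ≤ (ENNReal.ofReal (Real.exp ε₁) * ∫⁻ y, e₂ * g y ∂ν + ENNReal.ofReal δ₁)
          + ENNReal.ofReal δ₂ := by
        gcongr
        exact min_le_right _ _
    _ = _ := by
        rw [lintegral_const_mul _ hg, ← mul_assoc, ← ENNReal.ofReal_mul (Real.exp_nonneg _),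
          ← Real.exp_add, add_assoc, ← ENNReal.ofReal_add hδ₁ hδ₂]

/-- For `ε = 0` the inequality is symmetric (it bounds the total variation distance). -/
theorem Close.symm_of_zero {Y : Type*} [MeasurableSpace Y] {δ : ℝ} {μ ν : Measure Y}
    [IsProbabilityMeasure μ] [IsProbabilityMeasure ν] (h : Close 0 δ μ ν) : Close 0 δ ν μ :=
  fun S hS => by
    have h' := h Sᶜ hS.compl
    simp only [Real.exp_zero, ENNReal.ofReal_one, one_mul] at h' ⊢
    -- Adding `ν Sᶜ` to both sides makes the left side 1 and avoids subtraction in `ℝ≥0∞`.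
    refine ENNReal.le_of_add_le_add_right (a := ν Sᶜ) (measure_ne_top _ _) ?_
    rw [prob_add_prob_compl hS, ← prob_add_prob_compl (μ := μ) hS, add_assoc, add_comm _ (ν Sᶜ)]
    gcongr

/-! ### Powers of a measure -/

theorem measurable_snoc_swap {Z : Type*} [MeasurableSpace Z] (n : ℕ) :
    Measurable fun p : Z × (Fin n → Z) => Fin.snoc (α := fun _ => Z) p.2 p.1 :=
  (measurable_snoc n).comp measurable_swap

theorem pi_succ_eq_map_snoc {Z : Type*} [MeasurableSpace Z] (Q : Measure Z) [SigmaFinite Q]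
    (n : ℕ) :
    Measure.pi (fun _ : Fin (n + 1) => Q) =
      (Q.prod (Measure.pi fun _ : Fin n => Q)).map
        fun p => Fin.snoc (α := fun _ => Z) p.2 p.1 := by
  have h := (measurePreserving_piFinSuccAbove (fun _ : Fin (n + 1) => Q) (Fin.last n)).symm
  rw [← h.map_eq]
  congr 1
  funext p
  exact Fin.insertNth_last' p.1 p.2

/-- Total variation is subadditive over independent coordinates: composition with constant kernels
adds the `δ`s, while `ε` stays 0. -/
theorem Close.pi {Z : Type*} [MeasurableSpace Z] {c : ℝ} (hc : 0 ≤ c) {P Q : Measure Z}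
    [IsProbabilityMeasure P] [IsProbabilityMeasure Q] (h : Close 0 c P Q) (n : ℕ) :
    Close 0 (n * c) (Measure.pi fun _ : Fin n => P) (Measure.pi fun _ : Fin n => Q) := by
  induction n with
  | zero =>
    intro S _
    rw [Measure.pi_of_empty (fun _ => P), Measure.pi_of_empty (fun _ => Q)]
    simp
  | succ n ih =>
    rw [pi_succ_eq_map_snoc, pi_succ_eq_map_snoc]
    refine Close.map ?_ (measurable_snoc_swap n)
    have := Close.compProd (κ := Kernel.const Z (Measure.pi fun _ : Fin n => P))
      (η := Kernel.const Z (Measure.pi fun _ : Fin n => Q)) hc (by positivity) h fun _ => ih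
    rw [Measure.compProd_const, Measure.compProd_const] at this
    exact this.mono (by simp) (by push_cast; linarith)

/-! ### Large noise multipliers are certified -/

instance isProbabilityMeasure_gaussMixture {N : ℕ} (h : Hyper N) (σ : ℝ) :
    IsProbabilityMeasure (gaussMixture h.q σ) where
  measure_univ := by
    simp only [gaussMixture, Measure.coe_add, Pi.add_apply, Measure.smul_apply, measure_univ,
      smul_eq_mul, mul_one]
    rw [← ENNReal.ofReal_add (sub_nonneg.2 h.q_le_one) h.q_nonneg]
    simp

/-- Unit translates of a centred normal law are close in total variation. -/
theorem close_gaussianReal_one_zero {σ : ℝ} (hσ : 0 < σ) :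
    Close 0 σ⁻¹ (gaussianReal 1 (σ ^ 2).toNNReal) (gaussianReal 0 (σ ^ 2).toNNReal) := by
  set v := (σ ^ 2).toNNReal with hvdef
  have hv : v ≠ 0 := (Real.toNNReal_pos.2 (by positivity)).ne'
  have hvσ : (v : ℝ) = σ ^ 2 := Real.coe_toNNReal _ (by positivity)
  set P := gaussianReal 1 v with hP
  set Q := gaussianReal 0 v with hQ
  have hle : ∀ {m m' : ℝ} {A : Set ℝ}, MeasurableSet A →
      (∀ x ∈ A, (x - m') ^ 2 ≤ (x - m) ^ 2) → gaussianReal m v A ≤ gaussianReal m' v A := by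
    intro m m' A hA h
    rw [gaussianReal_apply _ hv, gaussianReal_apply _ hv]
    refine setLIntegral_mono (measurable_gaussianPDF _ _) fun x hx => ENNReal.ofReal_le_ofReal ?_
    unfold gaussianPDFReal
    have := h x hx
    gcongr
  intro S hS
  simp only [Real.exp_zero, ENNReal.ofReal_one, one_mul]
  -- The densities cross at the midpoint 1/2, so `P` can exceed `Q` only to the right of it.
  have h1 : P (S ∩ Set.Iic (1 / 2)) ≤ Q (S ∩ Set.Iic (1 / 2)) :=
    hle (hS.inter measurableSet_Iic) fun x hx => by
      have : x ≤ 1 / 2 := hx.2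
      nlinarith
  have h2 : ∀ A : Set ℝ, MeasurableSet A → Q (A ∩ Set.Ioi (1 / 2)) ≤ P (A ∩ Set.Ioi (1 / 2)) :=
    fun A hA => hle (hA.inter measurableSet_Ioi) fun x hx => by
      have : 1 / 2 < x := hx.2
      nlinarith
  -- By translation, the excess of `P` over `Q` on the right half-line is the `Q`-mass of a unit
  -- interval, at most the maximal density, which is below 1/σ.
  have h3 : P (Set.Ioi (1 / 2)) = Q (Set.Ioi (-(1 / 2))) := by
    have : P = Q.map (· + 1) := by rw [hQ, gaussianReal_map_add_const, zero_add]
    rw [this, Measure.map_apply (by fun_prop) measurableSet_Ioi]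
    congr 1
    ext x
    simp only [Set.mem_preimage, Set.mem_Ioi]
    constructor <;> intro h <;> linarith
  have h4 : Q (Set.Ioc (-(1 / 2)) (1 / 2)) ≤ ENNReal.ofReal σ⁻¹ := by
    rw [hQ, gaussianReal_apply _ hv]
    calc ∫⁻ x in Set.Ioc (-(1 / 2) : ℝ) (1 / 2), gaussianPDF 0 v x
        ≤ ∫⁻ _ in Set.Ioc (-(1 / 2) : ℝ) (1 / 2), ENNReal.ofReal σ⁻¹ := by
          refine lintegral_mono fun x => ENNReal.ofReal_le_ofReal ?_
          unfold gaussianPDFReal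
          have hexp : Real.exp (-(x - 0) ^ 2 / (2 * v)) ≤ 1 := by
            rw [Real.exp_le_one_iff]
            exact div_nonpos_of_nonpos_of_nonneg (by nlinarith [sq_nonneg (x - 0)]) (by positivity)
          have hsq : σ ≤ √(2 * Real.pi * v) := by
            rw [hvσ]
            refine Real.le_sqrt_of_sq_le ?_
            nlinarith [Real.pi_gt_three, sq_nonneg σ]
          calc (√(2 * Real.pi * v))⁻¹ * Real.exp (-(x - 0) ^ 2 / (2 * v))
              ≤ (√(2 * Real.pi * v))⁻¹ * 1 := by gcongr
            _ ≤ σ⁻¹ := by rw [mul_one]; gcongr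
      _ = ENNReal.ofReal σ⁻¹ := by
          rw [setLIntegral_const, Real.volume_Ioc]; norm_num
  have h5 : Q (Set.Ioi (-(1 / 2))) ≤ ENNReal.ofReal σ⁻¹ + Q (Set.Ioi (1 / 2)) := by
    rw [← Set.Ioc_union_Ioi_eq_Ioi (show (-(1 / 2) : ℝ) ≤ 1 / 2 by norm_num)]
    exact (measure_union_le _ _).trans (by gcongr)
  have split : ∀ (ρ : Measure ℝ) (A : Set ℝ), ρ (S ∩ A) + ρ (Sᶜ ∩ A) = ρ A := fun ρ A => by
    rw [Set.inter_comm S, Set.inter_comm Sᶜ, ← Set.sdiff_eq, measure_inter_add_sdiff _ hS]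
  -- As `Q ≤ P` on the half-line, the excess on a part of it is at most the excess on all of it.
  have h6 : P (S ∩ Set.Ioi (1 / 2)) ≤ Q (S ∩ Set.Ioi (1 / 2)) + ENNReal.ofReal σ⁻¹ := by
    refine ENNReal.le_of_add_le_add_right (a := P (Sᶜ ∩ Set.Ioi (1 / 2))) (measure_ne_top _ _) ?_
    rw [split P _, h3]
    refine h5.trans ?_
    rw [← split Q (Set.Ioi (1 / 2)), add_comm (Q (S ∩ _)) (ENNReal.ofReal _),
      add_assoc]
    gcongr _ + (_ + ?_)
    exact h2 _ hS.compl
  have h7 : ∀ ρ : Measure ℝ, ρ S = ρ (S ∩ Set.Iic (1 / 2)) + ρ (S ∩ Set.Ioi (1 / 2)) := fun ρ => by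
    rw [← measure_inter_add_sdiff S (measurableSet_Iic (a := (1 / 2 : ℝ))), Set.sdiff_eq,
      Set.compl_Iic]
  rw [h7 P, h7 Q, add_assoc]
  gcongr

theorem gdp_nonempty {N : ℕ} (h : Hyper N) {ε δ : ℝ} (hε : 0 ≤ ε) (hδ : 0 < δ) (T : ℕ) :
    (gdp ε δ h.q T).Nonempty := by
  -- Then T/σ = δ T/(T + 1) ≤ δ; the `+ 1` keeps σ positive when `T = 0`.
  set σ : ℝ := (T + 1) / δ
  have hσ : 0 < σ := by positivity
  have hone : Close 0 σ⁻¹ (gaussMixture h.q σ) (gaussianReal 0 (σ ^ 2).toNNReal) := fun S hS => by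
    have h1 := close_gaussianReal_one_zero hσ S hS
    simp only [Real.exp_zero, ENNReal.ofReal_one, one_mul] at h1 ⊢
    set Q := gaussianReal 0 (σ ^ 2).toNNReal
    have hq : ENNReal.ofReal (1 - h.q) + ENNReal.ofReal h.q = 1 := by
      rw [← ENNReal.ofReal_add (sub_nonneg.2 h.q_le_one) h.q_nonneg]; simp
    calc gaussMixture h.q σ S
        = ENNReal.ofReal (1 - h.q) * Q S
          + ENNReal.ofReal h.q * gaussianReal 1 (σ ^ 2).toNNReal S := by simp [gaussMixture, Q]
      _ ≤ ENNReal.ofReal (1 - h.q) * (Q S + ENNReal.ofReal σ⁻¹)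
          + ENNReal.ofReal h.q * (Q S + ENNReal.ofReal σ⁻¹) := by gcongr; exact le_self_add
      _ = _ := by rw [← add_mul, hq, one_mul]
  have hT : (T : ℝ) * σ⁻¹ ≤ δ := by
    rw [inv_div, ← mul_div_assoc, div_le_iff₀ (by positivity)]
    nlinarith
  have hc : 0 ≤ σ⁻¹ := by positivity
  exact ⟨σ, hσ, (hone.pi hc T).mono hε hT, (hone.symm_of_zero.pi hc T).mono hε hT⟩

/-! ### Simulating the noisy mean from a one-dimensional noise -/

/-- If `σ ‖v‖ ≤ s`, then `s Z - correction s σ v * ⟪v, Z⟫ v` with `Z` standard normal has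
covariance `s² I - σ² v vᵀ`. -/
noncomputable def correction {n : ℕ} (s σ : ℝ) (v : EuclideanSpace ℝ (Fin n)) : ℝ :=
  σ ^ 2 / (s + √(s ^ 2 - σ ^ 2 * ‖v‖ ^ 2))

/-- This quadratic is what makes (s I - c v vᵀ)² equal to s² I - σ² v vᵀ. `correction` is its
smaller root in rationalised form, which remains valid at `v = 0`. -/
theorem correction_quadratic {n : ℕ} {s σ : ℝ} (hs : 0 < s) {v : EuclideanSpace ℝ (Fin n)}
    (hv : σ ^ 2 * ‖v‖ ^ 2 ≤ s ^ 2) :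
    correction s σ v ^ 2 * ‖v‖ ^ 2 - 2 * s * correction s σ v + σ ^ 2 = 0 := by
  unfold correction
  set w := √(s ^ 2 - σ ^ 2 * ‖v‖ ^ 2)
  have hw : w ^ 2 = s ^ 2 - σ ^ 2 * ‖v‖ ^ 2 := Real.sq_sqrt (by linarith)
  have hw0 : 0 ≤ w := Real.sqrt_nonneg _
  have hne : s + w ≠ 0 := by positivity
  field_simp
  linear_combination σ ^ 2 * hw

/-- `m + z v + (noise with covariance s² I - σ² v vᵀ)`. -/
noncomputable def shiftedPoint {n : ℕ} (s σ : ℝ) (m v : EuclideanSpace ℝ (Fin n)) (z : ℝ)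
    (w : EuclideanSpace ℝ (Fin n)) : EuclideanSpace ℝ (Fin n) :=
  m + (z • v + (s • w - (correction s σ v * inner ℝ v w) • v))

theorem measurable_shiftedPoint {W : Type*} [MeasurableSpace W] {n : ℕ} (s σ : ℝ)
    {m v w : W → EuclideanSpace ℝ (Fin n)} {z : W → ℝ} (hm : Measurable m) (hv : Measurable v)
    (hz : Measurable z) (hw : Measurable w) :
    Measurable fun p => shiftedPoint s σ (m p) (v p) (z p) (w p) := by
  unfold shiftedPoint correction
  fun_prop

theorem measurable_shiftedPoint_right {n : ℕ} (s σ : ℝ) (m v : EuclideanSpace ℝ (Fin n)) (z : ℝ) :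
    Measurable (shiftedPoint s σ m v z) :=
  measurable_shiftedPoint s σ measurable_const measurable_const measurable_const measurable_id

/-- Compare characteristic functions: the covariance σ² v vᵀ contributed by the scalar fills exactly
the gap left by the corrected noise, and its mean `r` only translates by `r • v`. -/
theorem map_shiftedPoint {n : ℕ} {s σ : ℝ} (hs : 0 < s) {v : EuclideanSpace ℝ (Fin n)}
    (hv : σ ^ 2 * ‖v‖ ^ 2 ≤ s ^ 2) (m : EuclideanSpace ℝ (Fin n)) (r : ℝ) :
    ((gaussianReal r (σ ^ 2).toNNReal).prod (stdGaussian (EuclideanSpace ℝ (Fin n)))).map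
        (fun p => shiftedPoint s σ m v p.1 p.2) =
      (gaussianNoise n s).map (fun z => (m + r • v) + z) := by
  have hmeas : Measurable fun p : ℝ × EuclideanSpace ℝ (Fin n) =>
      shiftedPoint s σ m v p.1 p.2 :=
    measurable_shiftedPoint s σ measurable_const measurable_const measurable_fst measurable_snd
  have : IsProbabilityMeasure (((gaussianReal r (σ ^ 2).toNNReal).prod
      (stdGaussian (EuclideanSpace ℝ (Fin n)))).map (fun p => shiftedPoint s σ m v p.1 p.2)) :=
    Measure.isProbabilityMeasure_map hmeas.aemeasurable
  have : IsProbabilityMeasure ((gaussianNoise n s).map (fun z => (m + r • v) + z)) :=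
    Measure.isProbabilityMeasure_map (by fun_prop)
  refine Measure.ext_of_charFun (funext fun t => ?_)
  set c := correction s σ v
  set a : ℝ := inner ℝ v t
  have hcoe : (((σ ^ 2).toNNReal : NNReal) : ℝ) = σ ^ 2 := Real.coe_toNNReal _ (sq_nonneg σ)
  rw [charFun_map_const_add, gaussianNoise, charFun_map_smul, charFun_stdGaussian, charFun_apply,
    integral_map hmeas.aemeasurable (by fun_prop)]
  -- The map w ↦ s w - c ⟪v, w⟫ v is self-adjoint, so it can be moved onto `t`; the character then
  -- factors over the two independent variables.
  have hfac : ∀ p : ℝ × EuclideanSpace ℝ (Fin n),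
      Complex.exp ((inner ℝ (shiftedPoint s σ m v p.1 p.2) t : ℝ) * Complex.I) =
        Complex.exp ((inner ℝ m t : ℝ) * Complex.I) *
          (Complex.exp (a * p.1 * Complex.I) *
            Complex.exp ((inner ℝ p.2 (s • t - (c * a) • v) : ℝ) * Complex.I)) := fun p => by
    rw [← Complex.exp_add, ← Complex.exp_add]
    congr 1
    simp only [shiftedPoint, inner_add_left, inner_sub_left, inner_smul_left, inner_sub_right,
      inner_smul_right, conj_trivial]
    rw [real_inner_comm p.2 v]
    push_cast
    simp only [a, c]
    ring
  simp_rw [hfac]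
  rw [integral_const_mul,
    integral_prod_mul (fun z : ℝ => Complex.exp (a * z * Complex.I))
      (fun w : EuclideanSpace ℝ (Fin n) =>
        Complex.exp ((inner ℝ w (s • t - (c * a) • v) : ℝ) * Complex.I)),
    ← charFun_apply_real, ← charFun_apply, charFun_gaussianReal, charFun_stdGaussian,
    ← Complex.exp_add, ← Complex.exp_add, ← Complex.exp_add]
  congr 1
  have hn : ‖s • t - (c * a) • v‖ ^ 2 = ‖s • t‖ ^ 2 - σ ^ 2 * a ^ 2 := by
    rw [norm_sub_sq_real, norm_smul (c * a), mul_pow, inner_smul_left, inner_smul_right,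
      real_inner_comm, Real.norm_eq_abs, sq_abs]
    simp only [conj_trivial]
    change ‖s • t‖ ^ 2 - 2 * (s * (c * a * a)) + (c * a) ^ 2 * ‖v‖ ^ 2 = _
    linear_combination a ^ 2 * correction_quadratic hs hv
  have hn' : ((‖s • t - (c * a) • v‖ : ℝ) : ℂ) ^ 2 = (‖s • t‖ : ℂ) ^ 2 - σ ^ 2 * a ^ 2 := by
    exact_mod_cast congrArg (fun x : ℝ => (x : ℂ)) hn
  have hcoe' : (((σ ^ 2).toNNReal : NNReal) : ℂ) = (σ : ℂ) ^ 2 := by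
    exact_mod_cast congrArg (fun x : ℝ => (x : ℂ)) hcoe
  rw [hn', hcoe', inner_add_left, inner_smul_left]
  simp only [conj_trivial]
  push_cast
  ring

/-- `κ` is obtained by feeding a noise of law `Q` into the kernel `J`. -/
def Simulates {S Z Y : Type*} [MeasurableSpace S] [MeasurableSpace Z] [MeasurableSpace Y]
    (κ : Kernel S Y) (Q : Measure Z) (J : Kernel (S × Z) Y) : Prop :=
  ∀ s A, MeasurableSet A → κ s A = ∫⁻ z, J (s, z) A ∂Q

theorem Simulates.lintegral {S Z Y : Type*} [MeasurableSpace S] [MeasurableSpace Z]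
    [MeasurableSpace Y] {κ : Kernel S Y} {Q : Measure Z} {J : Kernel (S × Z) Y}
    (h : Simulates κ Q J) (s : S) {f : Y → ℝ≥0∞} (hf : Measurable f) :
    ∫⁻ y, f y ∂κ s = ∫⁻ z, ∫⁻ y, f y ∂J (s, z) ∂Q := by
  have hJ : Measurable fun z => J (s, z) := J.measurable.comp measurable_prodMk_left
  have : κ s = Q.bind fun z => J (s, z) := Measure.ext fun A hA => by
    rw [Measure.bind_apply hA hJ.aemeasurable, h s A hA]
  rw [this, Measure.lintegral_bind hJ.aemeasurable hf.aemeasurable]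

/-- The influence `(1 / B) clip_C (g x)` of the record `x` has norm at most `C`. -/
theorem norm_smul_clip_le {n B : ℕ} (hB : 0 < B) {C : ℝ} (hC : 0 < C)
    (g : EuclideanSpace ℝ (Fin n)) : ‖(B : ℝ)⁻¹ • clip C g‖ ≤ C := by
  have hB1 : (B : ℝ)⁻¹ ≤ 1 := inv_le_one_of_one_le₀ (by exact_mod_cast hB)
  have hmax : 0 < max 1 (‖g‖ / C) := lt_max_of_lt_left one_pos
  have hclip : ‖clip C g‖ ≤ C := by
    unfold clip
    rw [norm_smul, norm_inv, Real.norm_eq_abs, abs_of_pos hmax, inv_mul_le_iff₀ hmax]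
    have := le_max_right 1 (‖g‖ / C)
    calc ‖g‖ = ‖g‖ / C * C := by field_simp
      _ ≤ _ := by gcongr
  rw [norm_smul, norm_inv, RCLike.norm_natCast]
  calc (B : ℝ)⁻¹ * ‖clip C g‖ ≤ 1 * C := by gcongr
    _ = C := one_mul C

/-! ### The noisy clipped mean with and without the record -/

section NoisyMean

variable {X S : Type*} [MeasurableSpace S] {n N : ℕ} (h : Hyper N) (σ : ℝ)
  (g : X → S → EuclideanSpace ℝ (Fin n)) (hg : ∀ x, Measurable (g x)) (D : Finset X) (x : X)

theorem sum_ofReal_batchProb :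
    ∑ b ∈ D.powerset, ENNReal.ofReal (batchProb h.q D b) = 1 := by
  have h1 : ∀ b ∈ D.powerset, 0 ≤ batchProb h.q D b := fun b _ =>
    mul_nonneg (pow_nonneg h.q_nonneg _) (pow_nonneg (sub_nonneg.2 h.q_le_one) _)
  have h2 : ∑ b ∈ D.powerset, batchProb h.q D b = 1 := by
    have := Finset.sum_pow_mul_eq_add_pow h.q (1 - h.q) D
    simpa [batchProb] using this
  rw [← ENNReal.ofReal_sum_of_nonneg h1, h2, ENNReal.ofReal_one]

/-- The noisy mean over a batch from `D`, shifted by `z` times the influence of `x`. -/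
noncomputable def noisyMeanSim : Kernel (S × ℝ) (EuclideanSpace ℝ (Fin n)) where
  toFun p := ∑ b ∈ D.powerset, ENNReal.ofReal (batchProb h.q D b) •
    (stdGaussian (EuclideanSpace ℝ (Fin n))).map (shiftedPoint (σ * h.C) σ
      (clippedMean h.B h.C (fun x => g x p.1) b) ((h.B : ℝ)⁻¹ • clip h.C (g x p.1)) p.2)
  measurable' := by
    refine Measure.measurable_of_measurable_coe _ fun A hA => ?_
    simp only [Measure.coe_finsetSum, Finset.sum_apply, Measure.smul_apply, smul_eq_mul]
    refine Finset.measurable_sum _ fun b _ => Measurable.const_mul ?_ _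
    have hm : Measurable fun r : (S × ℝ) × EuclideanSpace ℝ (Fin n) =>
        shiftedPoint (σ * h.C) σ (clippedMean h.B h.C (fun x => g x r.1.1) b)
          ((h.B : ℝ)⁻¹ • clip h.C (g x r.1.1)) r.1.2 r.2 := by
      refine measurable_shiftedPoint _ _ ?_ ?_ (by fun_prop) measurable_snd
      · unfold clippedMean clip
        fun_prop
      · unfold clip
        fun_prop
    have := measurable_measure_prodMk_left (ν := stdGaussian (EuclideanSpace ℝ (Fin n))) (hm hA)
    convert this using 2 with p
    exact Measure.map_apply (hm.comp measurable_prodMk_left) hA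

theorem noisyMeanSim_apply (p : S × ℝ) {A : Set (EuclideanSpace ℝ (Fin n))}
    (hA : MeasurableSet A) :
    noisyMeanSim h σ g hg D x p A = ∑ b ∈ D.powerset, ENNReal.ofReal (batchProb h.q D b) *
      stdGaussian (EuclideanSpace ℝ (Fin n)) (shiftedPoint (σ * h.C) σ
        (clippedMean h.B h.C (fun x => g x p.1) b)
        ((h.B : ℝ)⁻¹ • clip h.C (g x p.1)) p.2 ⁻¹' A) := by
  change (∑ b ∈ D.powerset, ENNReal.ofReal (batchProb h.q D b) •
    (stdGaussian (EuclideanSpace ℝ (Fin n))).map (shiftedPoint (σ * h.C) σ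
      (clippedMean h.B h.C (fun x => g x p.1) b)
      ((h.B : ℝ)⁻¹ • clip h.C (g x p.1)) p.2)) A = _
  simp only [Measure.coe_finsetSum, Finset.sum_apply, Measure.smul_apply, smul_eq_mul]
  refine Finset.sum_congr rfl fun b _ => ?_
  rw [Measure.map_apply (measurable_shiftedPoint_right _ _ _ _ _) hA]

instance : IsMarkovKernel (noisyMeanSim h σ g hg D x) where
  isProbabilityMeasure p := ⟨by
    simp [noisyMeanSim_apply h σ g hg D x p MeasurableSet.univ, sum_ofReal_batchProb]⟩

theorem noisyMean_apply (s : S) {A : Set (EuclideanSpace ℝ (Fin n))} :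
    noisyMean h σ g hg D s A = ∑ b ∈ D.powerset, ENNReal.ofReal (batchProb h.q D b) *
      (gaussianNoise n (σ * h.C)).map
        (fun z => clippedMean h.B h.C (fun x => g x s) b + z) A := by
  change (∑ b ∈ D.powerset, ENNReal.ofReal (batchProb h.q D b) •
    (gaussianNoise n (σ * h.C)).map
      (fun z => clippedMean h.B h.C (fun x => g x s) b + z)) A = _
  simp only [Measure.coe_finsetSum, Finset.sum_apply, Measure.smul_apply, smul_eq_mul]

theorem lintegral_noisyMeanSim (hσ : 0 < σ) (r : ℝ) (s : S)
    {A : Set (EuclideanSpace ℝ (Fin n))} (hA : MeasurableSet A) :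
    ∫⁻ z, noisyMeanSim h σ g hg D x (s, z) A ∂gaussianReal r (σ ^ 2).toNNReal =
      ∑ b ∈ D.powerset, ENNReal.ofReal (batchProb h.q D b) *
        (gaussianNoise n (σ * h.C)).map (fun z => (clippedMean h.B h.C (fun x => g x s) b
          + r • (h.B : ℝ)⁻¹ • clip h.C (g x s)) + z) A := by
  have hm : ∀ m v : EuclideanSpace ℝ (Fin n),
      Measurable fun p : ℝ × EuclideanSpace ℝ (Fin n) =>
        shiftedPoint (σ * h.C) σ m v p.1 p.2 := fun m v =>
    measurable_shiftedPoint _ _ measurable_const measurable_const measurable_fst measurable_snd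
  -- Clipping enters here: the influence has norm at most `C`, so the residual covariance is
  -- positive semidefinite.
  have hv : σ ^ 2 * ‖(h.B : ℝ)⁻¹ • clip h.C (g x s)‖ ^ 2 ≤ (σ * h.C) ^ 2 := by
    rw [mul_pow]
    gcongr
    exact norm_smul_clip_le h.B_pos h.C_pos _
  have hm' : ∀ m v : EuclideanSpace ℝ (Fin n), Measurable fun z =>
      stdGaussian (EuclideanSpace ℝ (Fin n)) (shiftedPoint (σ * h.C) σ m v z ⁻¹' A) := fun m v =>
    measurable_measure_prodMk_left (hm m v hA)
  simp only [noisyMeanSim_apply h σ g hg D x _ hA]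
  rw [lintegral_finsetSum _ fun b _ => (hm' _ _).const_mul _]
  refine Finset.sum_congr rfl fun b _ => ?_
  rw [lintegral_const_mul _ (hm' _ _),
    ← map_shiftedPoint (mul_pos hσ h.C_pos) hv, Measure.map_apply (hm _ _) hA,
    Measure.prod_apply (hm _ _ hA)]
  rfl

theorem simulates_noisyMean (hσ : 0 < σ) :
    Simulates (noisyMean h σ g hg D) (gaussianReal 0 (σ ^ 2).toNNReal)
      (noisyMeanSim h σ g hg D x) := fun s A hA => by
  rw [lintegral_noisyMeanSim h σ g hg D x hσ 0 s hA, noisyMean_apply]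
  simp

/-- Condition on whether `x` joins the batch. It does so with probability q, independently of the
other records, and the two cases match the two mixture components. -/
theorem simulates_noisyMean_cons (hσ : 0 < σ) (hx : x ∉ D) :
    Simulates (noisyMean h σ g hg (D.cons x hx)) (gaussMixture h.q σ)
      (noisyMeanSim h σ g hg D x) := fun s A hA => by
  classical
  rw [gaussMixture, lintegral_add_measure, lintegral_smul_measure, lintegral_smul_measure,
    lintegral_noisyMeanSim h σ g hg D x hσ 0 s hA, lintegral_noisyMeanSim h σ g hg D x hσ 1 s hA,
    noisyMean_apply, Finset.cons_eq_insert, Finset.sum_powerset_insert hx]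
  simp only [smul_eq_mul, Finset.mul_sum, zero_smul, add_zero, one_smul]
  congr 1
  · refine Finset.sum_congr rfl fun b hb => ?_
    have hcard := Finset.card_le_card (Finset.mem_powerset.1 hb)
    rw [← mul_assoc, ← ENNReal.ofReal_mul (sub_nonneg.2 h.q_le_one)]
    congr 2
    rw [batchProb, batchProb, Finset.card_insert_of_notMem hx, Nat.sub_add_comm hcard, pow_succ]
    ring
  · refine Finset.sum_congr rfl fun b hb => ?_
    have hxb : x ∉ b := fun hxb => hx (Finset.mem_powerset.1 hb hxb)
    rw [← mul_assoc, ← ENNReal.ofReal_mul h.q_nonneg]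
    congr 2
    · rw [batchProb, batchProb, Finset.card_insert_of_notMem hx, Finset.card_insert_of_notMem hxb,
        Nat.add_sub_add_right, pow_succ]
      ring
    · refine congrArg (fun f => (gaussianNoise n (σ * h.C)).map f) (funext fun z => ?_)
      rw [clippedMean, clippedMean, Finset.sum_insert hxb, smul_add]
      abel

end NoisyMean

/-! ### Simulating the training loop -/

/-- The newest noise coordinate is integrated innermost, in accordance with the recursion of the
training loop. -/
theorem pi_succ_lintegral {Z : Type*} [MeasurableSpace Z] (Q : Measure Z) [SigmaFinite Q]
    (n : ℕ) {f : (Fin (n + 1) → Z) → ℝ≥0∞} (hf : Measurable f) :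
    ∫⁻ w, f w ∂Measure.pi (fun _ : Fin (n + 1) => Q) =
      ∫⁻ w, ∫⁻ z, f (Fin.snoc (α := fun _ => Z) w z) ∂Q ∂Measure.pi (fun _ : Fin n => Q) := by
  rw [pi_succ_eq_map_snoc, lintegral_map hf (measurable_snoc_swap n)]
  exact lintegral_prod_symm' _ (hf.comp (measurable_snoc_swap n))

section Train

variable {A Ω Z : Type*} [MeasurableSpace A] [MeasurableSpace Ω] [MeasurableSpace Z] {d : ℕ}
  (opt : Optimizer Ω d) (start : A → Params d) (hstart : Measurable start)

/-- The trajectory after one more optimizer step with noisy gradient `y`. -/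
def extend {T : ℕ} (τ : Fin (T + 1) → Ω × Params d) (y : Params d) :
    Fin (T + 2) → Ω × Params d :=
  Fin.snoc (α := fun _ => Ω × Params d) τ (opt.step (τ (Fin.last T), y))

theorem measurable_extend (T : ℕ) :
    Measurable fun p : (Fin (T + 1) → Ω × Params d) × Params d => extend opt p.1 p.2 := by
  have hs : Measurable fun p : (Fin (T + 1) → Ω × Params d) × Params d =>
      opt.step (p.1 (Fin.last T), p.2) := opt.measurable_step.comp (by fun_prop)
  exact (measurable_snoc (T + 1)).comp (measurable_fst.prodMk hs)

theorem train_succ_apply (G : Kernel (A × Params d) (Params d)) [IsMarkovKernel G] (T : ℕ)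
    (a : A) {B : Set (Fin (T + 2) → Ω × Params d)} (hB : MeasurableSet B) :
    train opt start hstart G (T + 1) a B =
      ∫⁻ τ, G (a, (τ (Fin.last T)).2) (extend opt τ ⁻¹' B) ∂train opt start hstart G T a := by
  have hs : Measurable fun r : (A × (Fin (T + 1) → Ω × Params d)) × Params d =>
      opt.step (r.1.2 (Fin.last T), r.2) := opt.measurable_step.comp (by fun_prop)
  have := Kernel.IsMarkovKernel.map (Kernel.id ×ₖ G.comap
    (fun p : A × (Fin (T + 1) → Ω × Params d) => (p.1, (p.2 (Fin.last T)).2)) (by fun_prop)) hs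
  rw [train, Kernel.map_apply' _ (measurable_snoc _) _ hB,
    Kernel.compProd_apply (measurable_snoc _ hB)]
  refine lintegral_congr fun τ => ?_
  have hB' : MeasurableSet (Prod.mk τ ⁻¹'
      ((fun p => Fin.snoc (α := fun _ => Ω × Params d) p.1 p.2) ⁻¹' B)) :=
    measurable_prodMk_left (measurable_snoc _ hB)
  rw [Kernel.map_apply' _ hs _ hB', Kernel.id_prod_apply' _ _ (hs hB')]
  rfl

/-- The training loop with the noisy gradient in step `t` computed by `J` from the `t`-th
coordinate of the noise vector. -/
noncomputable def trainSim (J : Kernel ((A × Params d) × Z) (Params d)) :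
    (T : ℕ) → Kernel (A × (Fin T → Z)) (Fin (T + 1) → Ω × Params d)
  | 0 => Kernel.deterministic (fun p _ => (opt.init, start p.1)) (by fun_prop)
  | T + 1 =>
    ((trainSim J T).comap (fun p : A × (Fin (T + 1) → Z) => (p.1, Fin.init p.2))
        (by unfold Fin.init; fun_prop) ⊗ₖ
      (Kernel.id ×ₖ J.comap (fun p : (A × (Fin (T + 1) → Z)) × (Fin (T + 1) → Ω × Params d) =>
        ((p.1.1, (p.2 (Fin.last T)).2), p.1.2 (Fin.last T))) (by fun_prop))).map
      fun p => extend opt p.1 p.2.2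

instance (J : Kernel ((A × Params d) × Z) (Params d)) [IsMarkovKernel J] (T : ℕ) :
    IsMarkovKernel (trainSim opt start hstart J T) := by
  induction T with
  | zero => unfold trainSim; infer_instance
  | succ T ih =>
    unfold trainSim
    exact Kernel.IsMarkovKernel.map _ ((measurable_extend opt T).comp
      (measurable_fst.prodMk (measurable_snd.comp measurable_snd)))

theorem trainSim_succ_apply (J : Kernel ((A × Params d) × Z) (Params d)) [IsMarkovKernel J]
    (T : ℕ) (a : A) (w : Fin T → Z) (z : Z)
    {B : Set (Fin (T + 2) → Ω × Params d)} (hB : MeasurableSet B) :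
    trainSim opt start hstart J (T + 1) (a, Fin.snoc (α := fun _ => Z) w z) B =
      ∫⁻ τ, J ((a, (τ (Fin.last T)).2), z) (extend opt τ ⁻¹' B)
        ∂trainSim opt start hstart J T (a, w) := by
  have hm : Measurable fun p : (Fin (T + 1) → Ω × Params d) ×
      (((A × (Fin (T + 1) → Z)) × (Fin (T + 1) → Ω × Params d)) × Params d) =>
      extend opt p.1 p.2.2 := (measurable_extend opt T).comp
    (measurable_fst.prodMk (measurable_snd.comp measurable_snd))
  rw [trainSim, Kernel.map_apply' _ hm _ hB, Kernel.compProd_apply (hm hB), Kernel.comap_apply,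
    Fin.init_snoc]
  refine lintegral_congr fun τ => ?_
  have hB' := measurable_prodMk_left (x := τ) (hm hB)
  rw [Kernel.id_prod_apply' _ _ hB', Kernel.comap_apply]
  simp only [Fin.snoc_last]
  rfl

/-- Induction on the number of steps: the fresh scalar is independent of the trajectory so far, so
Tonelli lets it be integrated after that trajectory. -/
theorem Simulates.train {G : Kernel (A × Params d) (Params d)} [IsMarkovKernel G]
    {Q : Measure Z} [IsProbabilityMeasure Q] {J : Kernel ((A × Params d) × Z) (Params d)}
    [IsMarkovKernel J] (h : Simulates G Q J) (T : ℕ) :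
    Simulates (train opt start hstart G T) (Measure.pi fun _ : Fin T => Q)
      (trainSim opt start hstart J T) := by
  induction T with
  | zero =>
    intro a B hB
    simp [DPSFT.train, trainSim, Kernel.deterministic_apply]
  | succ T ih =>
    intro a B hB
    have hmeas : Measurable fun p : (Fin (T + 1) → Ω × Params d) × Z =>
        J ((a, (p.1 (Fin.last T)).2), p.2) (extend opt p.1 ⁻¹' B) :=
      Kernel.measurable_kernel_prodMk_left
        (κ := J.comap (fun p : (Fin (T + 1) → Ω × Params d) × Z =>
          ((a, (p.1 (Fin.last T)).2), p.2)) (by fun_prop))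
        (t := {p | extend opt p.1.1 p.2 ∈ B})
        (((measurable_extend opt T).comp
          ((measurable_fst.comp measurable_fst).prodMk measurable_snd)) hB)
    have hsec : ∀ τ : Fin (T + 1) → Ω × Params d, MeasurableSet (extend opt τ ⁻¹' B) := fun τ =>
      (measurable_extend opt T).comp measurable_prodMk_left hB
    rw [train_succ_apply opt start hstart G T a hB,
      pi_succ_lintegral Q T (f := fun w => trainSim opt start hstart J (T + 1) (a, w) B)
        (((trainSim opt start hstart J (T + 1)).measurable_coe hB).comp measurable_prodMk_left)]
    simp_rw [trainSim_succ_apply opt start hstart J T a _ _ hB, h _ _ (hsec _)]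
    rw [ih.lintegral a hmeas.lintegral_prod_right']
    refine lintegral_congr fun w => ?_
    exact lintegral_lintegral_swap hmeas.aemeasurable

end Train

/-! ### Post-processing and comparison of simulated kernels -/

theorem Simulates.map {S Z Y Y' : Type*} [MeasurableSpace S] [MeasurableSpace Z]
    [MeasurableSpace Y] [MeasurableSpace Y'] {κ : Kernel S Y} {Q : Measure Z}
    {J : Kernel (S × Z) Y} (h : Simulates κ Q J) {f : Y → Y'} (hf : Measurable f) :
    Simulates (κ.map f) Q (J.map f) := fun s A hA => by
  simp only [Kernel.map_apply' _ hf _ hA]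
  exact h s _ (hf hA)

/-- Post-processing that may look at the input. -/
theorem Simulates.id_prod_map {S Z Y Y' : Type*} [MeasurableSpace S] [MeasurableSpace Z]
    [MeasurableSpace Y] [MeasurableSpace Y'] {κ : Kernel S Y} [IsSFiniteKernel κ] {Q : Measure Z}
    {J : Kernel (S × Z) Y} [IsSFiniteKernel J] (h : Simulates κ Q J) {f : S × Y → Y'}
    (hf : Measurable f) :
    Simulates ((Kernel.id ×ₖ κ).map f) Q
      ((Kernel.id ×ₖ J).map fun p => f (p.1.1, p.2)) := fun s A hA => by
  have hf' : Measurable fun p : (S × Z) × Y => f (p.1.1, p.2) := hf.comp (by fun_prop)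
  simp only [Kernel.map_apply' _ hf _ hA, Kernel.map_apply' _ hf' _ hA]
  rw [Kernel.id_prod_apply' _ _ (hf hA), h s _ (measurable_prodMk_left (hf hA))]
  refine lintegral_congr fun z => ?_
  rw [Kernel.id_prod_apply' _ _ (hf' hA)]
  rfl

/-- Two kernels simulated by the same kernel from close noise laws are close. -/
theorem Simulates.close {S Z Y : Type*} [MeasurableSpace S] [MeasurableSpace Z]
    [MeasurableSpace Y] {ε δ : ℝ} {κ η : Kernel S Y} {P Q : Measure Z} {J : Kernel (S × Z) Y}
    [IsMarkovKernel J] (hκ : Simulates κ P J) (hη : Simulates η Q J) (h : Close ε δ P Q) (s : S) :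
    Close ε δ (κ s) (η s) :=
  h.of_eq_lintegral (J.comap (Prod.mk s) measurable_prodMk_left) (fun A hA => hκ s A hA)
    fun A hA => hη s A hA

/-- To prove differential privacy for `x`, it is enough to simulate the mechanism with and
without `x` from a pair of noise laws that are close in both directions. -/
theorem isDPFor_of_simulates {X S Z Y : Type*} [MeasurableSpace S] [MeasurableSpace Z]
    [MeasurableSpace Y] {ε δ : ℝ} {P Q : Measure Z} (x : X) (M : Finset X → Kernel S Y)
    (J : Finset X → Kernel (S × Z) Y) [∀ D, IsMarkovKernel (J D)] (hPQ : Close ε δ P Q)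
    (hQP : Close ε δ Q P) (h₀ : ∀ D, Simulates (M D) Q (J D))
    (h₁ : ∀ D (hx : x ∉ D), Simulates (M (D.cons x hx)) P (J D)) (s : S) :
    IsDPFor x ε δ fun D => M D s := by
  rintro D D' (⟨hx, rfl⟩ | ⟨hx, rfl⟩)
  -- `Q` belongs to the dataset without `x`, so the order of the neighbours decides which inequality
  -- is used.
  · exact (h₀ D).close (h₁ D hx) hQP s
  · exact (h₁ D' hx).close (h₀ D') hPQ s

/-! ### Privacy of the two stages and of their composition -/

/-- A training run whose noisy gradients are simulated from a one-dimensional noise is private as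
soon as the noise multiplier is certified by the accountant. -/
theorem isDPFor_train_map {X A Ω Y : Type*} [MeasurableSpace A] [MeasurableSpace Ω]
    [MeasurableSpace Y] {d N : ℕ} (opt : Optimizer Ω d) (start : A → Params d)
    (hstart : Measurable start) (h : Hyper N) {σ ε δ : ℝ} (hσ : σ ∈ gdp ε δ h.q h.T) (x : X)
    (G : Finset X → Kernel (A × Params d) (Params d)) [∀ D, IsMarkovKernel (G D)]
    (J : Finset X → Kernel ((A × Params d) × ℝ) (Params d)) [∀ D, IsMarkovKernel (J D)]
    (h₀ : ∀ D, Simulates (G D) (gaussianReal 0 (σ ^ 2).toNNReal) (J D))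
    (h₁ : ∀ D (hx : x ∉ D), Simulates (G (D.cons x hx)) (gaussMixture h.q σ) (J D))
    {f : (Fin (h.T + 1) → Ω × Params d) → Y} (hf : Measurable f) (a : A) :
    IsDPFor x ε δ fun D => (train opt start hstart (G D) h.T).map f a := by
  have : ∀ D, IsMarkovKernel ((trainSim opt start hstart (J D) h.T).map f) := fun D =>
    Kernel.IsMarkovKernel.map _ hf
  exact isDPFor_of_simulates x (fun D => (train opt start hstart (G D) h.T).map f)
    (fun D => (trainSim opt start hstart (J D) h.T).map f) hσ.2.1 hσ.2.2
    (fun D => ((h₀ D).train opt start hstart h.T).map hf)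
    (fun D hx => ((h₁ D hx).train opt start hstart h.T).map hf) a

theorem isDPFor_stage1 {X Ω : Type*} [MeasurableSpace Ω] {d k N : ℕ} {hk : k ≤ d}
    (L : Params d → X → ℝ) (opt : Optimizer Ω d) (h : Hyper N)
    (svd : SVDRoutine (numRows h.T k) hk) {σ ε δ : ℝ} (hσ : σ ∈ gdp ε δ h.q h.T) (x : X)
    (Θ₀ : Params d) : IsDPFor x ε δ fun D => stage1 L opt h svd σ D Θ₀ := by
  have : ∀ D, IsMarkovKernel (fullNoisyGrad L h σ D) := fun D => by
    unfold fullNoisyGrad; infer_instance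
  exact isDPFor_train_map opt id measurable_id h hσ x (fullNoisyGrad L h σ)
    (fun D => noisyMeanSim h σ (fun x s => grad L x s.2)
      (fun x => (measurable_grad L x).comp measurable_snd) D x)
    (fun D => simulates_noisyMean h σ _ _ D x hσ.1)
    (fun D hx => simulates_noisyMean_cons h σ _ _ D x hσ.1 hx)
    (measurable_stage1Output _ svd) Θ₀

theorem measurable_lift {d k : ℕ} :
    Measurable fun r : ((Params d × Matrix (Fin d) (Fin k) ℝ) × Params d) ×
      EuclideanSpace ℝ (Fin k) => matVec r.1.1.2 r.2 :=
  measurable_matVec.comp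
    ((measurable_snd.comp (measurable_fst.comp measurable_fst)).prodMk measurable_snd)

/-- Clipping follows the projection, so the simulation takes place in `ℝᵏ` and works for any `P`,
orthonormal or not. Multiplication by `P` is post-processing, as `P` is part of the input and does
not depend on `D`. -/
theorem isDPFor_stage2 {X Ω : Type*} [MeasurableSpace Ω] {d k N : ℕ}
    (L : Params d → X → ℝ) (opt : Optimizer Ω d) (h : Hyper N) {σ ε δ : ℝ}
    (hσ : σ ∈ gdp ε δ h.q h.T) (x : X) (p : Params d × Matrix (Fin d) (Fin k) ℝ) :
    IsDPFor x ε δ fun D => stage2 L opt h σ D p := by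
  have h1 : ∀ D, IsMarkovKernel (subspaceNoisyGrad (k := k) L h σ D) := fun D => by
    unfold subspaceNoisyGrad; infer_instance
  have h2 : ∀ D, IsMarkovKernel (liftedNoisyGrad (k := k) L h σ D) := fun D =>
    Kernel.IsMarkovKernel.map _ measurable_lift
  have hg : ∀ x, Measurable fun s : (Params d × Matrix (Fin d) (Fin k) ℝ) × Params d =>
      matVec s.1.2.transpose (grad L x s.2) := fun x =>
    measurable_matVec.comp (((measurable_transpose.comp (measurable_snd.comp measurable_fst))).prodMk
      ((measurable_grad L x).comp measurable_snd))
  let J := fun D => noisyMeanSim h σ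
    (fun x (s : (Params d × Matrix (Fin d) (Fin k) ℝ) × Params d) =>
      matVec s.1.2.transpose (grad L x s.2)) hg D x
  let J' := fun D => (Kernel.id ×ₖ J D).map
    fun r : (((Params d × Matrix (Fin d) (Fin k) ℝ) × Params d) × ℝ) ×
      EuclideanSpace ℝ (Fin k) => matVec r.1.1.1.2 r.2
  have h3 : ∀ D, IsMarkovKernel (J' D) := fun D =>
    Kernel.IsMarkovKernel.map _ (measurable_lift.comp
      ((measurable_fst.comp measurable_fst).prodMk measurable_snd))
  exact isDPFor_train_map opt Prod.fst measurable_fst h hσ x (liftedNoisyGrad L h σ) J'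
    (fun D => (simulates_noisyMean h σ _ hg D x hσ.1).id_prod_map measurable_lift)
    (fun D hx => (simulates_noisyMean_cons h σ _ hg D x hσ.1 hx).id_prod_map measurable_lift)
    (by fun_prop) p

theorem isDPFor_dpsft {X Ω₁ Ω₂ : Type*} [MeasurableSpace Ω₁] [MeasurableSpace Ω₂]
    {d k N : ℕ} {hk : k ≤ d} (L : Params d → X → ℝ) (opt₁ : Optimizer Ω₁ d)
    (opt₂ : Optimizer Ω₂ d) (h₁ h₂ : Hyper N) (svd : SVDRoutine (numRows h₁.T k) hk)
    {σ₁ σ₂ ε₁ δ₁ ε₂ δ₂ : ℝ} (hδ₁ : 0 ≤ δ₁) (hδ₂ : 0 ≤ δ₂) (hσ₁ : σ₁ ∈ gdp ε₁ δ₁ h₁.q h₁.T)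
    (hσ₂ : σ₂ ∈ gdp ε₂ δ₂ h₂.q h₂.T) (x : X) (Θ₀ : Params d) :
    IsDPFor x (ε₁ + ε₂) (δ₁ + δ₂) fun D => dpsft L opt₁ opt₂ h₁ h₂ svd σ₁ σ₂ D Θ₀ := by
  -- Stage 2 ignores `Θ₀`, so for fixed `Θ₀` the procedure is a measure composed with a kernel.
  have key : ∀ D, dpsft L opt₁ opt₂ h₁ h₂ svd σ₁ σ₂ D Θ₀ =
      stage1 L opt₁ h₁ svd σ₁ D Θ₀ ⊗ₘ stage2 L opt₂ h₂ σ₂ D := fun D => by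
    refine Measure.ext fun A hA => ?_
    rw [dpsft, Kernel.compProd_apply hA, Measure.compProd_apply hA]
    rfl
  intro D D' hD
  simp only [key]
  exact (isDPFor_stage1 L opt₁ h₁ svd hσ₁ x Θ₀ D D' hD).compProd hδ₁ hδ₂
    fun p => isDPFor_stage2 L opt₂ h₂ hσ₂ x p D D' hD

end DPSFT

theorem mainTheorem1 {X Ω₁ Ω₂ : Type*} [MeasurableSpace Ω₁] [MeasurableSpace Ω₂]
    {d k N : ℕ} (hk : k ≤ d)
    (L : DPSFT.Params d → X → ℝ)
    (opt₁ : DPSFT.Optimizer Ω₁ d) (opt₂ : DPSFT.Optimizer Ω₂ d)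
    (h₁ h₂ : DPSFT.Hyper N)
    (svd : DPSFT.SVDRoutine (DPSFT.numRows h₁.T k) hk)
    (ε δ p₁ p₂ : ℝ) (hε : 0 ≤ ε) (hδ : 0 < δ)
    (hp₁ : p₁ ∈ Set.Ioo (0 : ℝ) 1) (hp₂ : p₂ ∈ Set.Ioo (0 : ℝ) 1) (hp : p₁ + p₂ = 1) :
    (DPSFT.gdp (p₁ * ε) (p₁ * δ) h₁.q h₁.T).Nonempty ∧
    (DPSFT.gdp (p₂ * ε) (p₂ * δ) h₂.q h₂.T).Nonempty ∧
    ∀ σ₁ ∈ DPSFT.gdp (p₁ * ε) (p₁ * δ) h₁.q h₁.T,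
    ∀ σ₂ ∈ DPSFT.gdp (p₂ * ε) (p₂ * δ) h₂.q h₂.T,
    ∀ (Θ₀ : DPSFT.Params d) (x : X),
      DPSFT.IsDPFor x (p₁ * ε) (p₁ * δ) (fun D => DPSFT.stage1 L opt₁ h₁ svd σ₁ D Θ₀) ∧
      (∀ (Θs : DPSFT.Params d) (P : Matrix (Fin d) (Fin k) ℝ),
        DPSFT.IsDPFor x (p₂ * ε) (p₂ * δ) (fun D => DPSFT.stage2 L opt₂ h₂ σ₂ D (Θs, P))) ∧
      DPSFT.IsDPFor x ε δ
        (fun D => DPSFT.dpsft L opt₁ opt₂ h₁ h₂ svd σ₁ σ₂ D Θ₀) := by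
  have h1 : 0 < p₁ * δ := mul_pos hp₁.1 hδ
  have h2 : 0 < p₂ * δ := mul_pos hp₂.1 hδ
  refine ⟨DPSFT.gdp_nonempty h₁ (mul_nonneg hp₁.1.le hε) h1 _,
    DPSFT.gdp_nonempty h₂ (mul_nonneg hp₂.1.le hε) h2 _, fun σ₁ hσ₁ σ₂ hσ₂ Θ₀ x =>
    ⟨DPSFT.isDPFor_stage1 L opt₁ h₁ svd hσ₁ x Θ₀, fun Θs P =>
      DPSFT.isDPFor_stage2 L opt₂ h₂ hσ₂ x (Θs, P), ?_⟩⟩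
  have := DPSFT.isDPFor_dpsft L opt₁ opt₂ h₁ h₂ svd h1.le h2.le hσ₁ hσ₂ x Θ₀
  rwa [← add_mul, ← add_mul, hp, one_mul, one_mul] at this
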